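/- For a commutative ring $R$ and $r\in R$, a $D(r)$ triple over $R$ is a triple $(a_1,a_2,a_3)\in R^3$ (entries need not be distinct) such that $a_ia_j+r$ is a square in $R$ for all $1\le i<j\le 3$. Let $K_1,K_2,\ldots$ be a sequence of non-archimedean local fields of characteristic $0$, let $\mathcal{O}_{K_i}$ be the valuation ring of $K_i$ and let $p_i$ be the residue characteristic of $K_i$, and suppose that $p_i\to\infty$ as $i\to\infty$. Let $r\neq 0$ be a fixed integer, viewed in each $\mathcal{O}_{K_i}$. Let $\mathrm{diop}_3^r(\mathcal{O}_{K_i})$ denote the measure of the set of $D(r)$ triples over $\mathcal{O}_{K_i}$ with respect to the product measure on $\mathcal{O}_{K_i}^3$ of the Haar measure on $\mathcal{O}_{K_i}$ normalized to have total mass $1$. Then, as $i\to\infty$, $$\mathrm{diop}_3^r(\mathcal{O}_{K_i})=\frac18+O\left(\frac1{p_i}\right).$$ -/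

import Mathlib

open MeasureTheory ValuativeRel

/-- The set of `D(r)` `m`-tuples over `R`: the `(a₁, …, aₘ) ∈ Rᵐ` (repetitions allowed) such that
`aᵢ aⱼ + r` is a square in `R` for all `i < j`. -/
def diophTuples (m : ℕ) (R : Type*) [CommRing R] (r : R) : Set (Fin m → R) :=
  {a | ∀ i j : Fin m, i < j → IsSquare (a i * a j + r)}

/-- The measure of the set of `D(r)` `m`-tuples over a compact topological ring `R`, for the product
measure on `Rᵐ` of the Haar measure of the additive group of `R`, normalized so that `R` has
measure `1`. -/
noncomputable def diophMeasure (m : ℕ) (R : Type*) [CommRing R] [TopologicalSpace R]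
    [IsTopologicalRing R] [CompactSpace R] (r : R) : ℝ :=
  letI : MeasurableSpace R := borel R
  haveI : BorelSpace R := ⟨rfl⟩
  (Measure.pi fun _ : Fin m => Measure.addHaarMeasure (⊤ : TopologicalSpace.PositiveCompacts R)).real
    (diophTuples m R r)

/-! Whether `x` is a square in the valuation ring is visible in the residue field `F`, of size `q`,
unless `x` reduces to 0: a nonzero square lifts by Hensel
(`HenselianRing.isSquare_of_isSquare_residue`). So the measure lies between `N / q ^ 3` and `(N + D)
/ q ^ 3`, where `N` counts triples over `F` with all `xᵢ xⱼ + r` nonzero squares and `D` those with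
some value 0. `D` is `O(q ^ 2)`, and `8 N` is, up to `O(D)`, the sum of `∏ (1 + χ(xᵢ xⱼ + r))`. The
constant term gives `q ^ 3`. The rest is `O(q ^ 2)` with no Weil bound: after fixing all variables
but one, only character sums of linear polynomials or products of two of them remain. -/

section FiniteField

variable {F : Type*} [Field F] [Fintype F] [DecidableEq F]

/-! ### Quadratic character sums over a finite field -/

lemma abs_quadraticChar_le_one (x : F) : |quadraticChar F x| ≤ 1 := by
  rcases quadraticChar_isQuadratic F x with h | h | h <;> simp [h]

lemma sum_quadraticChar_mul_add_eq_zero (hF : ringChar F ≠ 2) {b : F} (hb : b ≠ 0) (s : F) :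
    ∑ a : F, quadraticChar F (a * b + s) = 0 := by
  rw [← quadraticChar_sum_zero hF]
  exact Equiv.sum_comp ((Equiv.mulRight₀ b hb).trans (Equiv.addRight s)) (quadraticChar F)

lemma sum_quadraticChar_mul_quadraticChar (hF : ringChar F ≠ 2) (s : F) {t : F} (ht : t ≠ 0) :
    ∑ x : F, quadraticChar F x * quadraticChar F (s * x + t) = -quadraticChar F s := by
  -- Pull out the square `x ^ 2`. At `x = 0` the convention `0⁻¹ = 0` creates a spurious `χ(s)`,
  -- which is subtracted.
  have key (x : F) : quadraticChar F x * quadraticChar F (s * x + t) =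
      quadraticChar F (x⁻¹ * t + s) - if x = 0 then quadraticChar F s else 0 := by
    by_cases hx : x = 0
    · simp [hx]
    · have h : x * (s * x + t) = x ^ 2 * (x⁻¹ * t + s) := by field_simp; ring
      rw [← map_mul, h, map_mul, quadraticChar_sq_one' hx]
      simp [hx]
  have hinv : ∑ x : F, quadraticChar F (x⁻¹ * t + s) = 0 := by
    rw [← sum_quadraticChar_mul_add_eq_zero hF ht s]
    exact Equiv.sum_comp (Equiv.inv F) fun y => quadraticChar F (y * t + s)
  rw [Finset.sum_congr rfl fun x _ => key x, Finset.sum_sub_distrib, hinv,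
    Finset.sum_ite_eq' Finset.univ (0 : F), if_pos (Finset.mem_univ _), zero_sub]

lemma abs_sum_quadraticChar_mul_add_le (hF : ringChar F ≠ 2) (b r : F) :
    |∑ a : F, quadraticChar F (a * b + r)| ≤ if b = 0 then (Fintype.card F : ℤ) else 0 := by
  split_ifs with hb
  · refine (Finset.abs_sum_le_sum_abs _ _).trans
      ((Finset.sum_le_sum fun a _ => abs_quadraticChar_le_one _).trans ?_)
    simp
  · rw [sum_quadraticChar_mul_add_eq_zero hF hb, abs_zero]

/-- For `b ≠ 0`, substituting `x = a * b + r` gives the preceding product sum with `s = c / b`, `t =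
r * (1 - c / b)`; `t ≠ 0` off the diagonal `b = c`. -/
lemma abs_sum_quadraticChar_mul_quadraticChar_le (hF : ringChar F ≠ 2) {r : F} (hr : r ≠ 0)
    (b c : F) :
    |∑ a : F, quadraticChar F (a * b + r) * quadraticChar F (a * c + r)| ≤
      1 + if b = c then (Fintype.card F : ℤ) else 0 := by
  split_ifs with hbc
  · refine (Finset.abs_sum_le_sum_abs _ _).trans ((Finset.sum_le_sum (g := fun _ => 1)
      fun a _ => ?_).trans (by simp))
    rw [← map_mul]
    exact abs_quadraticChar_le_one _
  · by_cases hb : b = 0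
    · have hc : c ≠ 0 := fun h => hbc (hb.trans h.symm)
      simp only [hb, mul_zero, zero_add, ← Finset.mul_sum,
        sum_quadraticChar_mul_add_eq_zero hF hc, abs_zero, add_zero, zero_le_one]
    · have ht : r * (1 - c / b) ≠ 0 := by
        refine mul_ne_zero hr (sub_ne_zero.2 fun h => hbc ?_)
        rw [eq_div_iff hb] at h
        simpa using h
      have hsum : ∑ a : F, quadraticChar F (a * b + r) * quadraticChar F (a * c + r) =
          -quadraticChar F (c / b) := by
        rw [← sum_quadraticChar_mul_quadraticChar hF (c / b) ht,
          ← Equiv.sum_comp ((Equiv.mulRight₀ b hb).trans (Equiv.addRight r))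
            fun x => quadraticChar F x * quadraticChar F (c / b * x + r * (1 - c / b))]
        refine Finset.sum_congr rfl fun a _ => ?_
        simp only [Equiv.trans_apply, Equiv.mulRight₀_apply, Equiv.coe_addRight]
        congr 2
        field_simp
        ring
      rw [hsum, abs_neg, add_zero]
      exact abs_quadraticChar_le_one _

lemma sum_sum_one_add_ite_eq (α : Type*) [Fintype α] [DecidableEq α] :
    ∑ b : α, ∑ c : α, (1 + if b = c then (Fintype.card α : ℤ) else 0) =
      2 * (Fintype.card α : ℤ) ^ 2 := by
  simp [Finset.sum_add_distrib]
  ring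

/-- The weight does not involve `a`, so it factors out of the inner sum. `w = 1` serves the products
of two characters, `w = χ(b * c + r)` the product of all three. -/
lemma abs_sum_sum_sum_weighted_le (hF : ringChar F ≠ 2) {r : F} (hr : r ≠ 0) (w : F → F → ℤ)
    (hw : ∀ b c, |w b c| ≤ 1) :
    |∑ b : F, ∑ c : F, ∑ a : F,
      w b c * (quadraticChar F (a * b + r) * quadraticChar F (a * c + r))| ≤
      2 * (Fintype.card F : ℤ) ^ 2 := by
  rw [← sum_sum_one_add_ite_eq]
  refine (Finset.abs_sum_le_sum_abs _ _).trans (Finset.sum_le_sum fun b _ => ?_)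
  refine (Finset.abs_sum_le_sum_abs _ _).trans (Finset.sum_le_sum fun c _ => ?_)
  rw [← Finset.mul_sum, abs_mul]
  have h := abs_sum_quadraticChar_mul_quadraticChar_le hF hr b c
  exact (mul_le_of_le_one_left (abs_nonneg _) (hw b c)).trans h

lemma abs_sum_sum_sum_quadraticChar_le (hF : ringChar F ≠ 2) (r : F) :
    |∑ _c : F, ∑ b : F, ∑ a : F, quadraticChar F (a * b + r)| ≤ (Fintype.card F : ℤ) ^ 2 := by
  have h : ∑ _c : F, ∑ b : F, (if b = 0 then (Fintype.card F : ℤ) else 0) =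
      (Fintype.card F : ℤ) ^ 2 := by
    simp
    ring
  rw [← h]
  refine (Finset.abs_sum_le_sum_abs _ _).trans (Finset.sum_le_sum fun c _ => ?_)
  exact (Finset.abs_sum_le_sum_abs _ _).trans
    (Finset.sum_le_sum fun b _ => abs_sum_quadraticChar_mul_add_le hF b r)

/-- The constant is `11 = 3 * 1 + 3 * 2 + 2`: three single characters, three pairs, one triple
product, each relabelled to a sum already bounded. -/
lemma abs_sum_prod_one_add_quadraticChar_sub_le (hF : ringChar F ≠ 2) {r : F} (hr : r ≠ 0) :
    |∑ a : F, ∑ b : F, ∑ c : F, (1 + quadraticChar F (a * b + r)) *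
      (1 + quadraticChar F (a * c + r)) * (1 + quadraticChar F (b * c + r)) -
      (Fintype.card F : ℤ) ^ 3| ≤ 11 * (Fintype.card F : ℤ) ^ 2 := by
  set χ := quadraticChar F
  have e1 : ∑ a : F, ∑ b : F, ∑ c : F, (1 : ℤ) = (Fintype.card F : ℤ) ^ 3 := by
    simp
    ring
  have l := abs_sum_sum_sum_quadraticChar_le hF r
  have m := abs_sum_sum_sum_weighted_le hF hr (fun _ _ => 1) (by simp)
  have t := abs_sum_sum_sum_weighted_le hF hr (fun b c => χ (b * c + r))
    (fun b c => abs_quadraticChar_le_one _)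
  simp only [one_mul] at m
  have comm (f : F → F → F → ℤ) :
      ∑ a : F, ∑ b : F, ∑ c : F, f a b c = ∑ b : F, ∑ c : F, ∑ a : F, f a b c := by
    rw [Finset.sum_comm]
    exact Finset.sum_congr rfl fun b _ => Finset.sum_comm
  have l1 : ∑ a : F, ∑ b : F, ∑ c : F, χ (a * b + r) =
      ∑ c : F, ∑ b : F, ∑ a : F, χ (a * b + r) := by
    rw [comm, comm]
    exact Finset.sum_congr rfl fun c _ => Finset.sum_comm
  have l2 : ∑ a : F, ∑ b : F, ∑ c : F, χ (a * c + r) =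
      ∑ c : F, ∑ b : F, ∑ a : F, χ (a * b + r) := by
    rw [Finset.sum_comm]
    exact Finset.sum_congr rfl fun c _ => Finset.sum_comm
  have l3 : ∑ a : F, ∑ b : F, ∑ c : F, χ (b * c + r) =
      ∑ c : F, ∑ b : F, ∑ a : F, χ (a * b + r) :=
    Finset.sum_congr rfl fun c _ => Finset.sum_comm
  have m1 : ∑ a : F, ∑ b : F, ∑ c : F, χ (a * b + r) * χ (a * c + r) =
      ∑ b : F, ∑ c : F, ∑ a : F, χ (a * b + r) * χ (a * c + r) := comm _
  have m2 : ∑ a : F, ∑ b : F, ∑ c : F, χ (a * b + r) * χ (b * c + r) =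
      ∑ b : F, ∑ c : F, ∑ a : F, χ (a * b + r) * χ (a * c + r) := by
    refine Finset.sum_congr rfl fun a _ => ?_
    rw [Finset.sum_comm]
    simp only [mul_comm]
  have m3 : ∑ a : F, ∑ b : F, ∑ c : F, χ (a * c + r) * χ (b * c + r) =
      ∑ b : F, ∑ c : F, ∑ a : F, χ (a * b + r) * χ (a * c + r) := by
    refine Finset.sum_congr rfl fun a _ => Finset.sum_congr rfl fun b _ =>
      Finset.sum_congr rfl fun c _ => ?_
    rw [mul_comm a c, mul_comm b c]
  have t1 : ∑ a : F, ∑ b : F, ∑ c : F, χ (a * b + r) * χ (a * c + r) * χ (b * c + r) =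
      ∑ b : F, ∑ c : F, ∑ a : F, χ (b * c + r) * (χ (a * b + r) * χ (a * c + r)) := by
    rw [comm]
    simp only [mul_comm]
  have expand (a b c : F) : (1 + χ (a * b + r)) * (1 + χ (a * c + r)) * (1 + χ (b * c + r)) =
      1 + χ (a * b + r) + χ (a * c + r) + χ (b * c + r) + χ (a * b + r) * χ (a * c + r) +
      χ (a * b + r) * χ (b * c + r) + χ (a * c + r) * χ (b * c + r) +
      χ (a * b + r) * χ (a * c + r) * χ (b * c + r) := by ring
  simp only [expand, Finset.sum_add_distrib]
  rw [e1, l1, l2, l3, m1, m2, m3, t1]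
  rw [abs_le] at *
  constructor <;> linarith [l.1, l.2, m.1, m.2, t.1, t.2]

lemma sum_sum_sum_ite_mul_add_eq_zero_le {r : F} (hr : r ≠ 0) :
    ∑ a : F, ∑ b : F, ∑ _c : F, (if a * b + r = 0 then (1 : ℤ) else 0) ≤
      (Fintype.card F : ℤ) ^ 2 := by
  have h (a : F) : ∑ b : F, (if a * b + r = 0 then (1 : ℤ) else 0) ≤ 1 := by
    rw [Finset.sum_boole]
    norm_cast
    refine Finset.card_le_one.2 fun b hb c hc => ?_
    simp only [Finset.mem_filter, Finset.mem_univ, true_and] at hb hc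
    -- Since `r ≠ 0`, a solution forces `a ≠ 0`, and then `b` is determined.
    have ha : a ≠ 0 := by
      rintro rfl
      simp [hr] at hb
    exact mul_left_cancel₀ ha (add_right_cancel (hb.trans hc.symm))
  calc _ = ∑ a : F, (Fintype.card F : ℤ) * ∑ b : F, (if a * b + r = 0 then (1 : ℤ) else 0) := by
        refine Finset.sum_congr rfl fun a _ => ?_
        simp only [Finset.sum_const, Finset.card_univ, nsmul_eq_mul, Finset.mul_sum]
    _ ≤ ∑ a : F, (Fintype.card F : ℤ) * 1 :=
        Finset.sum_le_sum fun a _ => mul_le_mul_of_nonneg_left (h a) (by positivity)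
    _ = _ := by
        simp
        ring

/-! ### Counting triples over the residue field -/

/-- Functions on `Fin 3` as triples. -/
def finThreeArrowEquivProd (α : Type*) : (Fin 3 → α) ≃ α × α × α where
  toFun x := (x 0, x 1, x 2)
  invFun p := ![p.1, p.2.1, p.2.2]
  left_inv x := by
    ext i
    fin_cases i <;> rfl
  right_inv _ := rfl

lemma sum_finThree_arrow {α : Type*} [Fintype α] (f : α → α → α → ℤ) :
    ∑ x : Fin 3 → α, f (x 0) (x 1) (x 2) = ∑ a : α, ∑ b : α, ∑ c : α, f a b c := by
  rw [← Fintype.sum_equiv (finThreeArrowEquivProd α).symm (fun p => f p.1 p.2.1 p.2.2) _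
    (fun _ => rfl), Fintype.sum_prod_type]
  exact Finset.sum_congr rfl fun a _ => Fintype.sum_prod_type _

/-- The triples over `F` some of whose values `xᵢ xⱼ + r` vanish. -/
def degenerateTriples (r : F) : Finset (Fin 3 → F) :=
  {x | x 0 * x 1 + r = 0 ∨ x 0 * x 2 + r = 0 ∨ x 1 * x 2 + r = 0}

/-- The triples over `F` all of whose values `xᵢ xⱼ + r` are nonzero squares. -/
def nonzeroSquareTriples (r : F) : Finset (Fin 3 → F) :=
  {x | quadraticChar F (x 0 * x 1 + r) = 1 ∧ quadraticChar F (x 0 * x 2 + r) = 1 ∧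
    quadraticChar F (x 1 * x 2 + r) = 1}

lemma ite_or_or_le (p q s : Prop) [Decidable p] [Decidable q] [Decidable s] :
    (if p ∨ q ∨ s then (1 : ℤ) else 0) ≤
      (if p then 1 else 0) + (if q then 1 else 0) + (if s then 1 else 0) := by
  by_cases hp : p <;> by_cases hq : q <;> by_cases hs : s <;> simp [hp, hq, hs]

lemma card_degenerateTriples_le {r : F} (hr : r ≠ 0) :
    ((degenerateTriples r).card : ℤ) ≤ 3 * (Fintype.card F : ℤ) ^ 2 := by
  have h := sum_sum_sum_ite_mul_add_eq_zero_le hr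
  have h2 : ∑ a : F, ∑ b : F, ∑ c : F, (if a * c + r = 0 then (1 : ℤ) else 0) =
      ∑ a : F, ∑ b : F, ∑ c : F, (if a * b + r = 0 then (1 : ℤ) else 0) :=
    Finset.sum_congr rfl fun a _ => Finset.sum_comm
  have h3 : ∑ a : F, ∑ b : F, ∑ c : F, (if b * c + r = 0 then (1 : ℤ) else 0) =
      ∑ a : F, ∑ b : F, ∑ c : F, (if a * b + r = 0 then (1 : ℤ) else 0) := by
    rw [Finset.sum_comm]
    exact Finset.sum_congr rfl fun a _ => Finset.sum_comm
  have hsum := sum_finThree_arrow fun a b c : F => (if a * b + r = 0 then (1 : ℤ) else 0) +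
    (if a * c + r = 0 then 1 else 0) + (if b * c + r = 0 then 1 else 0)
  simp only [Finset.sum_add_distrib] at hsum
  rw [h2, h3] at hsum
  have hle : ((degenerateTriples r).card : ℤ) ≤
      ∑ x : Fin 3 → F, ((if x 0 * x 1 + r = 0 then (1 : ℤ) else 0) +
        (if x 0 * x 2 + r = 0 then 1 else 0) + (if x 1 * x 2 + r = 0 then 1 else 0)) := by
    rw [degenerateTriples, ← Finset.sum_boole]
    exact Finset.sum_le_sum fun x _ => ite_or_or_le _ _ _
  simp only [Finset.sum_add_distrib] at hle
  linarith

/-- The product of the `1 + χ` is 8 on these triples, and elsewhere vanishes unless some value is 0.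
Hence `35 = 11 + 8 * 3`. -/
lemma abs_card_nonzeroSquareTriples_sub_le (hF : ringChar F ≠ 2) {r : F} (hr : r ≠ 0) :
    |8 * ((nonzeroSquareTriples r).card : ℤ) - (Fintype.card F : ℤ) ^ 3| ≤
      35 * (Fintype.card F : ℤ) ^ 2 := by
  have hS := abs_sum_prod_one_add_quadraticChar_sub_le hF hr
  have hB := card_degenerateTriples_le hr
  rw [← sum_finThree_arrow (fun a b c => (1 + quadraticChar F (a * b + r)) *
      (1 + quadraticChar F (a * c + r)) * (1 + quadraticChar F (b * c + r)))] at hS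
  set S := ∑ x : Fin 3 → F, (1 + quadraticChar F (x 0 * x 1 + r)) *
      (1 + quadraticChar F (x 0 * x 2 + r)) * (1 + quadraticChar F (x 1 * x 2 + r)) with hSdef
  have bounds (u v w : F) :
      8 * (if quadraticChar F u = 1 ∧ quadraticChar F v = 1 ∧ quadraticChar F w = 1
        then (1 : ℤ) else 0) ≤
        (1 + quadraticChar F u) * (1 + quadraticChar F v) * (1 + quadraticChar F w) ∧
      (1 + quadraticChar F u) * (1 + quadraticChar F v) * (1 + quadraticChar F w) ≤
        8 * (if quadraticChar F u = 1 ∧ quadraticChar F v = 1 ∧ quadraticChar F w = 1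
          then (1 : ℤ) else 0) + 8 * (if u = 0 ∨ v = 0 ∨ w = 0 then (1 : ℤ) else 0) := by
    simp only [← quadraticChar_eq_zero_iff (F := F)]
    rcases quadraticChar_isQuadratic F u with hu | hu | hu <;>
    rcases quadraticChar_isQuadratic F v with hv | hv | hv <;>
    rcases quadraticChar_isQuadratic F w with hw | hw | hw <;>
    rw [hu, hv, hw] <;> decide
  have lower : 8 * ((nonzeroSquareTriples r).card : ℤ) ≤ S := by
    rw [nonzeroSquareTriples, ← Finset.sum_boole, Finset.mul_sum]
    exact Finset.sum_le_sum fun x _ => (bounds _ _ _).1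
  have upper : S ≤ 8 * ((nonzeroSquareTriples r).card : ℤ) +
      8 * ((degenerateTriples r).card : ℤ) := by
    rw [nonzeroSquareTriples, degenerateTriples, ← Finset.sum_boole, ← Finset.sum_boole,
      Finset.mul_sum, Finset.mul_sum, ← Finset.sum_add_distrib]
    exact Finset.sum_le_sum fun x _ => (bounds _ _ _).2
  rw [abs_le] at *
  constructor <;> linarith [hS.1, hS.2]

end FiniteField

/-! ### Hensel lifting and Haar measure over a local ring -/

section LocalRing

open IsLocalRing

variable {R : Type*} [CommRing R] [IsLocalRing R]

lemma HenselianRing.isSquare_of_isSquare_residue [HenselianRing R (maximalIdeal R)]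
    (h2 : ringChar (ResidueField R) ≠ 2) {u : R} (hu : residue R u ≠ 0)
    (hsq : IsSquare (residue R u)) : IsSquare u := by
  obtain ⟨y, hy⟩ := hsq
  obtain ⟨b, rfl⟩ := residue_surjective y
  have hb : residue R b ≠ 0 := by
    intro h
    exact hu (by simpa [h] using hy)
  have hroot : (Polynomial.X ^ 2 - Polynomial.C u).eval b ∈ maximalIdeal R := by
    rw [← residue_eq_zero_iff]
    simp [hy, sq]
  -- The derivative `2 * b` is a unit: the residue characteristic is not 2 and `b` is nonzero in the
  -- residue field.
  have hder : IsUnit (Ideal.Quotient.mk (maximalIdeal R)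
      ((Polynomial.X ^ 2 - Polynomial.C u).derivative.eval b)) := by
    have hd : residue R ((Polynomial.X ^ 2 - Polynomial.C u).derivative.eval b) =
        2 * residue R b := by
      simp [one_add_one_eq_two, map_ofNat (residue R) 2]
    change IsUnit (residue R _)
    rw [hd]
    exact (mul_ne_zero (Ring.two_ne_zero h2) hb).isUnit
  obtain ⟨a, ha, -⟩ := HenselianRing.is_henselian (I := maximalIdeal R)
    (Polynomial.X ^ 2 - Polynomial.C u) (Polynomial.monic_X_pow_sub_C u two_ne_zero) b hroot hder
  refine ⟨a, ?_⟩
  have : a ^ 2 - u = 0 := by simpa [Polynomial.IsRoot] using ha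
  rw [← sq]
  exact (sub_eq_zero.1 this).symm

section Measure

variable [TopologicalSpace R] [MeasurableSpace R] [BorelSpace R] [IsTopologicalRing R]

lemma measurableSet_residue_preimage_singleton (hm : IsClosed (maximalIdeal R : Set R))
    (x : ResidueField R) : MeasurableSet (residue R ⁻¹' {x}) := by
  obtain ⟨b, rfl⟩ := residue_surjective x
  have : residue R ⁻¹' {residue R b} = (fun y => y - b) ⁻¹' (maximalIdeal R : Set R) := by
    ext y
    rw [Set.mem_preimage, Set.mem_preimage, SetLike.mem_coe, ← residue_eq_zero_iff, map_sub,
      sub_eq_zero, Set.mem_singleton_iff]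
  rw [this]
  exact (hm.preimage (by fun_prop)).measurableSet

/-- The residue classes are translates of one another, so they share the total mass 1 equally. -/
lemma measureReal_residue_preimage_singleton [Fintype (ResidueField R)]
    (hm : IsClosed (maximalIdeal R : Set R)) (μ : Measure R) [IsProbabilityMeasure μ]
    [μ.IsAddLeftInvariant] (x : ResidueField R) :
    μ.real (residue R ⁻¹' {x}) = 1 / Fintype.card (ResidueField R) := by
  have htrans (y : ResidueField R) :
      μ.real (residue R ⁻¹' {y}) = μ.real (residue R ⁻¹' {0}) := by
    obtain ⟨b, rfl⟩ := residue_surjective y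
    have : residue R ⁻¹' {residue R b} = (fun z => -b + z) ⁻¹' (residue R ⁻¹' {0}) := by
      ext z
      simp only [Set.mem_preimage, Set.mem_singleton_iff, map_add, map_neg, neg_add_eq_zero]
      exact eq_comm
    rw [this, measureReal_def, measure_preimage_add, ← measureReal_def]
  have hsum := sum_measureReal_preimage_singleton (μ := μ) Finset.univ (f := residue R)
    fun y _ => measurableSet_residue_preimage_singleton hm y
  simp only [htrans, Finset.sum_const, Finset.card_univ, nsmul_eq_mul, Finset.coe_univ,
    Set.preimage_univ, probReal_univ] at hsum
  rw [htrans, eq_div_iff (by simp [Fintype.card_ne_zero]), mul_comm]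
  exact hsum

lemma measureReal_pi_residue_preimage [Fintype (ResidueField R)]
    (hm : IsClosed (maximalIdeal R : Set R)) (μ : Measure R) [IsProbabilityMeasure μ]
    [μ.IsAddLeftInvariant] {ι : Type*} [Fintype ι] (S : Finset (ι → ResidueField R)) :
    (Measure.pi fun _ : ι => μ).real ((fun a i => residue R (a i)) ⁻¹' (S : Set _)) =
      S.card / (Fintype.card (ResidueField R) : ℝ) ^ Fintype.card ι := by
  have hpi (x : ι → ResidueField R) : (fun (a : ι → R) i => residue R (a i)) ⁻¹' {x} =
      Set.univ.pi fun i => residue R ⁻¹' {x i} := by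
    ext a
    simp [funext_iff]
  rw [← sum_measureReal_preimage_singleton]
  · have (x : ι → ResidueField R) :
        (Measure.pi fun _ : ι => μ).real ((fun (a : ι → R) i => residue R (a i)) ⁻¹' {x}) =
          (1 / Fintype.card (ResidueField R) : ℝ) ^ Fintype.card ι := by
      rw [hpi, measureReal_def, Measure.pi_pi, ENNReal.toReal_prod]
      simp only [← measureReal_def, measureReal_residue_preimage_singleton hm μ,
        Finset.prod_const, Finset.card_univ]
    simp [this, div_eq_mul_inv]
  · intro x _
    rw [hpi]
    exact MeasurableSet.univ_pi fun i => measurableSet_residue_preimage_singleton hm (x i)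

end Measure

section DiophTuples

variable [Fintype (ResidueField R)] [DecidableEq (ResidueField R)]

lemma residue_preimage_nonzeroSquareTriples_subset [HenselianRing R (maximalIdeal R)]
    (h2 : ringChar (ResidueField R) ≠ 2) (r : R) :
    (fun a i => residue R (a i)) ⁻¹' (nonzeroSquareTriples (residue R r) : Set _) ⊆
      diophTuples 3 R r := by
  have lift (a b : R)
      (h : quadraticChar (ResidueField R) (residue R a * residue R b + residue R r) = 1) :
      IsSquare (a * b + r) := by
    rw [← map_mul, ← map_add] at h
    have h0 : residue R (a * b + r) ≠ 0 := by
      intro h0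
      rw [h0, quadraticChar_zero] at h
      exact zero_ne_one h
    exact HenselianRing.isSquare_of_isSquare_residue h2 h0
      ((quadraticChar_one_iff_isSquare h0).1 h)
  intro a ha
  simp only [nonzeroSquareTriples, Finset.coe_filter, Finset.mem_univ, true_and,
    Set.mem_preimage, Set.mem_ofPred_eq] at ha
  intro i j hij
  fin_cases i <;> fin_cases j <;> first | exact absurd hij (by decide) | skip
  · exact lift _ _ ha.1
  · exact lift _ _ ha.2.1
  · exact lift _ _ ha.2.2

lemma diophTuples_subset_residue_preimage (r : R) :
    diophTuples 3 R r ⊆ (fun a i => residue R (a i)) ⁻¹'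
      ((nonzeroSquareTriples (residue R r) ∪ degenerateTriples (residue R r) : Finset _) :
        Set (Fin 3 → ResidueField R)) := by
  have red (a b : R) (h : IsSquare (a * b + r))
      (h0 : residue R a * residue R b + residue R r ≠ 0) :
      quadraticChar (ResidueField R) (residue R a * residue R b + residue R r) = 1 := by
    rw [quadraticChar_one_iff_isSquare h0, ← map_mul, ← map_add]
    exact h.map (residue R)
  intro a ha
  simp only [nonzeroSquareTriples, degenerateTriples, Finset.coe_union, Finset.coe_filter,
    Finset.mem_univ, true_and, Set.mem_preimage, Set.mem_union, Set.mem_ofPred_eq]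
  by_contra! hc
  exact hc.1 (red _ _ (ha 0 1 (by decide)) hc.2.1) (red _ _ (ha 0 2 (by decide)) hc.2.2.1)
    (red _ _ (ha 1 2 (by decide)) hc.2.2.2)

end DiophTuples

theorem abs_diophMeasure_three_sub_le [TopologicalSpace R] [IsTopologicalRing R] [CompactSpace R]
    [HenselianRing R (maximalIdeal R)] [Fintype (ResidueField R)]
    (hm : IsClosed (maximalIdeal R : Set R)) (h2 : ringChar (ResidueField R) ≠ 2) {r : R}
    (hr : residue R r ≠ 0) :
    |diophMeasure 3 R r - 1 / 8| ≤ 8 / Fintype.card (ResidueField R) := by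
  classical
  let : MeasurableSpace R := borel R
  have : BorelSpace R := ⟨rfl⟩
  let μ : Measure R := Measure.addHaarMeasure (⊤ : TopologicalSpace.PositiveCompacts R)
  have : IsProbabilityMeasure μ := ⟨Measure.addHaarMeasure_self⟩
  set q : ℝ := (Fintype.card (ResidueField R) : ℝ)
  have hq : 0 < q := by
    simp only [q]
    exact_mod_cast Fintype.card_pos
  have hD : diophMeasure 3 R r = (Measure.pi fun _ : Fin 3 => μ).real (diophTuples 3 R r) := rfl
  have lower := measureReal_mono (μ := Measure.pi fun _ : Fin 3 => μ)
    (residue_preimage_nonzeroSquareTriples_subset h2 r)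
  have upper := measureReal_mono (μ := Measure.pi fun _ : Fin 3 => μ)
    (diophTuples_subset_residue_preimage r)
  rw [measureReal_pi_residue_preimage hm μ, ← hD] at lower upper
  rw [Fintype.card_fin] at lower upper
  have hG : |8 * ((nonzeroSquareTriples (residue R r)).card : ℝ) - q ^ 3| ≤ 35 * q ^ 2 := by
    have h := (Int.cast_le (R := ℝ)).2 (abs_card_nonzeroSquareTriples_sub_le h2 hr)
    push_cast at h
    exact h
  have hB : ((degenerateTriples (residue R r)).card : ℝ) ≤ 3 * q ^ 2 := by
    have h := (Int.cast_le (R := ℝ)).2 (card_degenerateTriples_le hr)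
    push_cast at h
    exact h
  have hU : ((nonzeroSquareTriples (residue R r) ∪ degenerateTriples (residue R r)).card : ℝ) ≤
      (nonzeroSquareTriples (residue R r)).card + (degenerateTriples (residue R r)).card := by
    exact_mod_cast Finset.card_union_le _ _
  rw [div_le_iff₀ (by positivity)] at lower
  rw [le_div_iff₀ (by positivity)] at upper
  rw [abs_le] at hG
  -- The error is at most `35 / 8` below and `35 / 8 + 3 = 59 / 8` above, in units of `q ^ 2`; 8
  -- covers both.
  have key : |(diophMeasure 3 R r - 1 / 8) * q ^ 3| ≤ 8 * q ^ 2 := by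
    rw [abs_le]
    constructor <;> nlinarith [hG.1, hG.2, sq_nonneg q]
  rw [abs_mul, abs_of_pos (by positivity : 0 < q ^ 3)] at key
  rw [le_div_iff₀ hq]
  refine le_of_mul_le_mul_right ?_ (by positivity : 0 < q ^ 2)
  linarith

end LocalRing

/-! ### Local fields and the asymptotic statement -/

section LocalField

variable (K : Type*) [Field K] [ValuativeRel K] [TopologicalSpace K] [IsNonarchimedeanLocalField K]

lemma IsNonarchimedeanLocalField.henselianRing_integer : HenselianRing 𝒪[K] 𝓂[K] := by
  let := IsTopologicalAddGroup.rightUniformSpace K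
  have := isUniformAddGroup_of_addCommGroup (G := K)
  infer_instance

lemma IsNonarchimedeanLocalField.isClosed_maximalIdeal : IsClosed (𝓂[K] : Set 𝒪[K]) := by
  let := IsTopologicalAddGroup.rightUniformSpace K
  have := isUniformAddGroup_of_addCommGroup (G := K)
  exact IsNoetherianRing.isClosed_ideal _

theorem abs_diophMeasure_three_intCast_sub_le {r : ℤ} (hr : r ≠ 0)
    (h2 : 2 < ringChar 𝓀[K]) (hrp : r.natAbs < ringChar 𝓀[K]) :
    |diophMeasure 3 𝒪[K] (r : 𝒪[K]) - 1 / 8| ≤ 8 / (ringChar 𝓀[K] : ℝ) := by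
  have := IsNonarchimedeanLocalField.henselianRing_integer K
  let : Fintype 𝓀[K] := Fintype.ofFinite _
  have hres : IsLocalRing.residue 𝒪[K] (r : 𝒪[K]) ≠ 0 := by
    rw [map_intCast]
    intro h
    rw [CharP.intCast_eq_zero_iff 𝓀[K] (ringChar 𝓀[K])] at h
    exact hr (Int.eq_zero_of_dvd_of_natAbs_lt_natAbs h (by simpa using hrp))
  refine (abs_diophMeasure_three_sub_le (IsNonarchimedeanLocalField.isClosed_maximalIdeal K)
    h2.ne' hres).trans ?_
  -- The cardinality is 0 in the residue field, so the characteristic divides it.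
  have hle : ringChar 𝓀[K] ≤ Fintype.card 𝓀[K] :=
    Nat.le_of_dvd Fintype.card_pos ((CharP.cast_eq_zero_iff 𝓀[K] (ringChar 𝓀[K]) _).1 (by simp))
  have hpos : (0 : ℝ) < ringChar 𝓀[K] := by
    exact_mod_cast (by omega : 0 < ringChar 𝓀[K])
  gcongr

end LocalField

theorem mainTheorem11 (K : ℕ → Type*) [∀ i, Field (K i)] [∀ i, CharZero (K i)]
    [∀ i, ValuativeRel (K i)] [∀ i, TopologicalSpace (K i)]
    [∀ i, IsNonarchimedeanLocalField (K i)]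
    (hp : Filter.Tendsto (fun i => ringChar 𝓀[K i]) Filter.atTop Filter.atTop)
    (r : ℤ) (hr : r ≠ 0) :
    (fun i => diophMeasure 3 𝒪[K i] (r : 𝒪[K i]) - 1 / 8) =O[Filter.atTop]
      (fun i => 1 / (ringChar 𝓀[K i] : ℝ)) := by
  refine Asymptotics.IsBigO.of_bound 8 ?_
  -- Eventually `p > 2` and `p > |r|`, so `p` is odd and `r` is nonzero in the residue field.
  filter_upwards [hp.eventually_gt_atTop 2, hp.eventually_gt_atTop r.natAbs] with i h2 hrp
  rw [Real.norm_eq_abs, Real.norm_of_nonneg (by positivity), mul_one_div]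
  exact abs_diophMeasure_three_intCast_sub_le (K i) hr h2 hrp
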